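/- Let $g,\lambda,B$ be real-valued functions on $\mathbb{N}$ such that $g$ is positive and increasing, $g(n)\to\infty$, $g(n)=o(n^{1/3})$, and, for all $n\ge 1$, $|\lambda(n)|\le g(n)$ and $B(n)\le n^{2/3}/g(n)^2$. Suppose also that $B(n)\to\infty$. Let $G\sim G\big(n,\frac{1+\lambda(n)n^{-1/3}}{n}\big)$ be the random graph on $n$ vertices in which each edge is present independently with probability $\frac{1+\lambda(n)n^{-1/3}}{n}$, and let $|S_B|$ denote the number of connected components of $G$ whose number of vertices lies in the interval $[B(n),2B(n)]$. Then there exist constants $\delta_1,\delta_2>0$, independent of $n$, such that $$\Pr\left[|S_B|\le \frac{\delta_1 n}{B(n)^{3/2}}\right]\le \frac{\delta_2 B(n)^{3/2}}{n}$$ for every $n\ge 1$ for which $B(n)>0$ and $0\le\frac{1+\lambda(n)n^{-1/3}}{n}\le 1$ (this holds for all sufficiently large $n$). -/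

import Mathlib

open Filter Asymptotics MeasureTheory

/-- The number of vertices in a connected component of a graph. -/
noncomputable def componentSize {V : Type*} {G : SimpleGraph V} (c : G.ConnectedComponent) : ℕ :=
  c.supp.ncard

/-- The set of connected components of `G` whose size lies in the real interval `[B, 2B]`. -/
def componentsInWindow {V : Type*} (G : SimpleGraph V) (B : ℝ) : Set G.ConnectedComponent :=
  {c | B ≤ (componentSize c : ℝ) ∧ (componentSize c : ℝ) ≤ 2 * B}

/-- The edge probability `(1 + l * n ^ (-1/3)) / n` in the critical window. -/
noncomputable def criticalEdgeProb (n : ℕ) (l : ℝ) : ℝ :=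
  (1 + l * (n : ℝ) ^ (-(1 / 3) : ℝ)) / n

/-!
Already the components that are trees are numerous enough, and their number `Y` is concentrated by
Chebyshev's inequality. The probability that a given `k`-set is a tree component is exact: Cayley's
formula, proved here by adding the layers of a rooted tree one at a time, gives
`k ^ (k - 2) p ^ (k - 1) (1 - p) ^ m` with `m` the number of absent edges. Write `p n = 1 + ε`. If
`ε ^ 2 b ≤ 1`, Stirling's formula makes this times `n.choose k` at least of order `n / k ^ (5 / 2)`
for `k ∈ [b, 2 b]`, so that the mean of `Y` is at least of order `n / b ^ (3 / 2)`.

Two tree components that meet are equal, and for disjoint sets of sizes `j` and `k` the joint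
probability is the product of the two probabilities divided by `(1 - p) ^ (j k)`, since the
`j k` pairs between them are counted only once. As one set leaves only `n - j` vertices for the
other, `(n - j).choose k ≤ exp (-j k / n) n.choose k` compensates this factor up to
`1 + O(b ^ (3 / 2) / n)`, which is also the order of the relative variance `1 / 𝔼[Y]`.
-/

open Finset ProbabilityTheory

section SecondMoment

variable {Ω ι : Type*} [MeasurableSpace Ω] {μ : Measure Ω} {I : Finset ι}
  {E : ι → Set Ω}

theorem memLp_sum_indicator_one [IsFiniteMeasure μ] (hE : ∀ i ∈ I, MeasurableSet (E i)) :
    MemLp (fun ω => ∑ i ∈ I, (E i).indicator (1 : Ω → ℝ) ω) 2 μ :=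
  memLp_finsetSum I fun i hi => memLp_indicator_const 2 (hE i hi) 1 (.inr (measure_ne_top _ _))

theorem integral_sum_indicator_one [IsFiniteMeasure μ] (hE : ∀ i ∈ I, MeasurableSet (E i)) :
    ∫ ω, ∑ i ∈ I, (E i).indicator (1 : Ω → ℝ) ω ∂μ = ∑ i ∈ I, μ.real (E i) := by
  have hint : Integrable (1 : Ω → ℝ) μ := integrable_const 1
  rw [integral_finsetSum I fun i hi => hint.indicator (hE i hi)]
  exact sum_congr rfl fun i hi => integral_indicator_one (hE i hi)

theorem integral_sum_indicator_one_sq [IsFiniteMeasure μ]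
    (hE : ∀ i ∈ I, MeasurableSet (E i)) :
    ∫ ω, (∑ i ∈ I, (E i).indicator (1 : Ω → ℝ) ω) ^ 2 ∂μ =
      ∑ i ∈ I, ∑ j ∈ I, μ.real (E i ∩ E j) := by
  simp only [sq, sum_mul_sum, ← Pi.mul_apply ((E _).indicator _), ← Set.inter_indicator_one]
  simp only [← sum_product']
  exact integral_sum_indicator_one fun ij hij =>
    (hE _ (mem_product.1 hij).1).inter (hE _ (mem_product.1 hij).2)

theorem measureReal_sum_indicator_le_half [IsProbabilityMeasure μ] [DecidableEq ι] {M x : ℝ}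
    (hE : ∀ i ∈ I, MeasurableSet (E i)) (hM : ∑ i ∈ I, μ.real (E i) = M) (hM0 : 0 < M)
    (hpair : ∑ i ∈ I, ∑ j ∈ I.erase i, μ.real (E i ∩ E j) ≤ (1 + x) * M ^ 2) :
    μ.real {ω | ∑ i ∈ I, (E i).indicator (1 : Ω → ℝ) ω ≤ M / 2} ≤ 4 * (1 / M + x) := by
  set Y : Ω → ℝ := fun ω => ∑ i ∈ I, (E i).indicator (1 : Ω → ℝ) ω
  have hmean : ∫ ω, Y ω ∂μ = M := (integral_sum_indicator_one hE).trans hM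
  have hsq : ∫ ω, (Y ^ 2) ω ∂μ ≤ M + (1 + x) * M ^ 2 :=
    calc ∫ ω, (Y ^ 2) ω ∂μ = ∑ i ∈ I, ∑ j ∈ I, μ.real (E i ∩ E j) :=
          integral_sum_indicator_one_sq hE
      _ = ∑ i ∈ I, (μ.real (E i) + ∑ j ∈ I.erase i, μ.real (E i ∩ E j)) :=
          sum_congr rfl fun i hi => by rw [← add_sum_erase _ _ hi, Set.inter_self]
      _ ≤ M + (1 + x) * M ^ 2 := by rw [sum_add_distrib, hM]; gcongr
  have hvar : Var[Y; μ] ≤ M + x * M ^ 2 := by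
    rw [variance_eq_sub (memLp_sum_indicator_one hE), hmean]
    linarith
  have hcheb : μ.real {ω | M / 2 ≤ |Y ω - ∫ ω, Y ω ∂μ|} ≤ Var[Y; μ] / (M / 2) ^ 2 :=
    ENNReal.toReal_le_of_le_ofReal (by have := variance_nonneg Y μ; positivity)
      (meas_ge_le_variance_div_sq (memLp_sum_indicator_one hE) (half_pos hM0))
  calc μ.real {ω | Y ω ≤ M / 2} ≤ μ.real {ω | M / 2 ≤ |Y ω - ∫ ω, Y ω ∂μ|} := by
        refine measureReal_mono fun ω (hω : Y ω ≤ M / 2) => ?_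
        rw [Set.mem_ofPred_eq, hmean]
        exact le_abs.2 (.inr (by linarith))
    _ ≤ (M + x * M ^ 2) / (M / 2) ^ 2 := hcheb.trans (by gcongr)
    _ = 4 * (1 / M + x) := by field_simp; ring

end SecondMoment

section Cylinder

open unitInterval

variable {p : I}

theorem setBernoulli_real_inter_eq {ι : Type*} {u : Set ι} {F T : Finset ι}
    (hFu : (F : Set ι) ⊆ u) (hTF : T ⊆ F) :
    setBer(u, p).real {s | s ∩ F = T} = (p : ℝ) ^ #T * (1 - p) ^ (#F - #T) := by
  classical
  have hcyl : (fun q : ι → Prop => {i | q i}) ⁻¹' {s : Set ι | s ∩ F = T} =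
      (F : Set ι).pi fun i => {i ∈ T} := by
    ext q
    have := fun i => @hTF i
    simp only [Set.mem_preimage, Set.mem_ofPred_eq, Set.ext_iff, Set.mem_inter_iff, mem_coe,
      Set.mem_pi, Set.mem_singleton_iff, eq_iff_iff]
    grind
  have hfactor : ∀ i ∈ F, (toNNReal p • Measure.dirac (i ∈ u) +
      toNNReal (σ p) • Measure.dirac False) {i ∈ T} =
        if i ∈ T then (toNNReal p : ENNReal) else toNNReal (σ p) := by
    intro i hi
    by_cases hiT : i ∈ T <;> simp [hiT, hFu hi]
  rw [measureReal_def, setBernoulli_apply', hcyl, Measure.infinitePi_pi _ (by simp),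
    prod_congr rfl hfactor, prod_ite, prod_const, prod_const, filter_mem_eq_inter,
    filter_notMem_eq_sdiff, inter_eq_right.2 hTF, card_sdiff_of_subset hTF]
  simp

variable {V : Type*} [Countable V] {F T : Finset (Sym2 V)}

theorem measurableSet_edgeSet_inter_eq (F T : Set (Sym2 V)) :
    MeasurableSet {G : SimpleGraph V | G.edgeSet ∩ F = T} := by
  have hmeas : Measurable fun G : SimpleGraph V => G.edgeSet ∩ F :=
    measurable_set_iff.2 fun e => by simp only [Set.mem_inter_iff]; fun_prop
  exact hmeas (measurableSet_singleton T)

theorem binomialRandom_real_edgeSet_inter_eq (hF : (F : Set (Sym2 V)) ⊆ Sym2.diagSetᶜ)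
    (hTF : T ⊆ F) :
    (SimpleGraph.binomialRandom V p).real {G | G.edgeSet ∩ F = T} =
      (p : ℝ) ^ #T * (1 - p) ^ (#F - #T) := by
  have himage : SimpleGraph.edgeSet '' {G : SimpleGraph V | G.edgeSet ∩ F = T} =
      {s ∈ {s : Set (Sym2 V) | s ∩ F = T} | s ⊆ Sym2.diagSetᶜ} := by
    ext s
    constructor
    · rintro ⟨G, hG, rfl⟩
      exact ⟨hG, G.edgeSet_subset_compl_diagSet⟩
    · rintro ⟨hs, hdiag⟩
      have : (SimpleGraph.fromEdgeSet s).edgeSet = s := by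
        rwa [SimpleGraph.edgeSet_fromEdgeSet, sdiff_eq_left, ← Set.subset_compl_iff_disjoint_right]
      exact ⟨.fromEdgeSet s, by rwa [Set.mem_ofPred_eq, this], this⟩
  rw [measureReal_def, SimpleGraph.binomialRandom_apply', himage,
    ← setBernoulli_apply_eq_apply_subsets (u := Sym2.diagSetᶜ), ← measureReal_def,
    setBernoulli_real_inter_eq hF hTF]

theorem binomialRandom_real_exists_edgeSet_inter_eq {𝒯 : Finset (Finset (Sym2 V))} {m : ℕ}
    (hF : (F : Set (Sym2 V)) ⊆ Sym2.diagSetᶜ) (h𝒯F : ∀ T ∈ 𝒯, T ⊆ F) (hcard : ∀ T ∈ 𝒯, #T = m) :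
    (SimpleGraph.binomialRandom V p).real {G | ∃ T ∈ 𝒯, G.edgeSet ∩ F = T} =
      #𝒯 * ((p : ℝ) ^ m * (1 - p) ^ (#F - m)) := by
  have hunion : {G : SimpleGraph V | ∃ T ∈ 𝒯, G.edgeSet ∩ F = T} =
      ⋃ T ∈ 𝒯, {G | G.edgeSet ∩ (F : Set (Sym2 V)) = T} := by
    ext G; simp
  rw [hunion, measureReal_biUnion_finset, ← nsmul_eq_mul, ← sum_const]
  · refine sum_congr rfl fun T hT => ?_
    rw [binomialRandom_real_edgeSet_inter_eq hF (h𝒯F T hT), hcard T hT]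
  · intro T _ T' _ hne
    refine Set.disjoint_left.2 fun G hG hG' => hne (coe_injective (hG.symm.trans hG'))
  · exact fun T _ => measurableSet_edgeSet_inter_eq _ _

end Cylinder

section RootedForest

open scoped FinsetFamily

theorem sum_choose_mul_mul_pow_mul_pow {S : Type*} [CommSemiring S] (x y : S) (m : ℕ) :
    ∑ i ∈ range (m + 2), (m + 1).choose i * (i * x ^ i * y ^ (m + 1 - i)) =
      (m + 1) * x * (x + y) ^ m := by
  rw [sum_range_succ', add_pow, mul_sum]
  simp only [Nat.cast_zero, zero_mul, mul_zero, add_zero, Nat.add_sub_add_right]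
  refine sum_congr rfl fun i _ => ?_
  have habsorb := congrArg (Nat.cast (R := S)) (Nat.add_one_mul_choose_eq m i)
  push_cast at habsorb ⊢
  calc ((m + 1).choose (i + 1) : S) * ((i + 1) * x ^ (i + 1) * y ^ (m - i))
      = ((m + 1).choose (i + 1) * (i + 1)) * (x ^ (i + 1) * y ^ (m - i)) := by ring
    _ = (m + 1) * x * (x ^ i * y ^ (m - i) * m.choose i) := by rw [← habsorb]; ring

theorem add_mul_sum_powerset_card_mul_pow_mul_pow {S α : Type*} [CommSemiring S] (x y : S)
    (U : Finset α) :
    (x + y) * ∑ I ∈ U.powerset, #I * x ^ #I * y ^ (#U - #I) = #U * x * (x + y) ^ #U := by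
  rcases U.eq_empty_or_nonempty with rfl | hU
  · simp
  obtain ⟨m, hm⟩ := Nat.exists_eq_add_of_lt hU.card_pos
  have hsum := sum_choose_mul_mul_pow_mul_pow x y m
  rw [sum_powerset_apply_card fun i => i * x ^ i * y ^ (#U - i)]
  simp only [hm, zero_add, nsmul_eq_mul, hsum]
  push_cast
  ring

variable {V : Type*} [DecidableEq V] {R U I A B : Finset V} {S T : Finset (Sym2 V)} {k : ℕ}

theorem card_sups_of_separated {α : Type*} [DecidableEq α] {𝒜 ℬ : Finset (Finset α)} (K : Set α)
    (h𝒜 : ∀ S ∈ 𝒜, ∀ e ∈ S, e ∈ K) (hℬ : ∀ T ∈ ℬ, ∀ e ∈ T, e ∉ K) :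
    #(𝒜 ⊻ ℬ) = #𝒜 * #ℬ := by
  refine (card_sups_iff _ _).2 ?_
  rintro ⟨S, T⟩ h ⟨S', T'⟩ h' (heq : S ∪ T = S' ∪ T')
  have hsep : ∀ {S T}, S ∈ 𝒜 → T ∈ ℬ → ∀ e,
      (e ∈ S ↔ e ∈ S ∪ T ∧ e ∈ K) ∧ (e ∈ T ↔ e ∈ S ∪ T ∧ e ∉ K) := by
    intro S T hS hT e
    have := h𝒜 S hS e
    have := hℬ T hT e
    grind
  ext e
  · rw [(hsep h.1 h.2 e).1, (hsep h'.1 h'.2 e).1, heq]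
  · rw [(hsep h.1 h.2 e).2, (hsep h'.1 h'.2 e).2, heq]

/-- The sets of edges obtained by joining every vertex of `I` to one vertex of `R`, its parent. -/
def parentEdgeSets (R I : Finset V) : Finset (Finset (Sym2 V)) :=
  (Fintype.piFinset fun _ : I => R).image fun f => univ.image fun u : I => s(f u, ↑u)

theorem mem_parentEdgeSets :
    S ∈ parentEdgeSets R I ↔
      ∃ f : I → V, (∀ u, f u ∈ R) ∧ univ.image (fun u : I => s(f u, ↑u)) = S := by
  simp only [parentEdgeSets, mem_image, Fintype.mem_piFinset]

theorem mk_mem_image_mk_iff (f : I → V) (hRI : Disjoint R I) {r : V} (hr : r ∈ R) (u : V) :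
    s(r, u) ∈ univ.image (fun u : I => s(f u, ↑u)) ↔ ∃ hu : u ∈ I, f ⟨u, hu⟩ = r := by
  simp only [mem_image, mem_univ, true_and, Sym2.eq_iff, Subtype.exists]
  have := disjoint_left.1 hRI hr
  grind

theorem card_parentEdgeSets (hRI : Disjoint R I) : #(parentEdgeSets R I) = #R ^ #I := by
  rw [parentEdgeSets, card_image_of_injOn, Fintype.card_piFinset, prod_const, card_univ,
    Fintype.card_coe]
  intro f hf g hg hfg
  simp only [mem_coe, Fintype.mem_piFinset] at hf hg
  beta_reduce at hfg
  funext u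
  have hmem := (mk_mem_image_mk_iff f hRI (hf u) u).2 ⟨u.2, rfl⟩
  rw [hfg] at hmem
  exact ((mk_mem_image_mk_iff g hRI (hf u) u).1 hmem).2.symm

theorem card_of_mem_parentEdgeSets (hRI : Disjoint R I) (hS : S ∈ parentEdgeSets R I) :
    #S = #I := by
  obtain ⟨f, hf, rfl⟩ := mem_parentEdgeSets.1 hS
  rw [card_image_of_injective, card_univ, Fintype.card_coe]
  intro u w huw
  have := disjoint_left.1 hRI (hf u)
  rcases Sym2.eq_iff.1 huw with ⟨-, h⟩ | ⟨h, -⟩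
  · exact Subtype.ext h
  · exact absurd (h ▸ w.2) this

/-- The edge sets of the forests of height at most `k` on `R ∪ U` whose trees have the vertices of
`R` as their roots, built layer by layer: `I` is the set of vertices at distance one from `R`. -/
def rootedForests : ℕ → Finset V → Finset V → Finset (Finset (Sym2 V))
  | 0, _, U => if U = ∅ then {∅} else ∅
  | k + 1, R, U => U.powerset.biUnion fun I => parentEdgeSets R I ⊻ rootedForests k I (U \ I)

theorem mem_rootedForests_zero : T ∈ rootedForests 0 R U ↔ U = ∅ ∧ T = ∅ := by
  unfold rootedForests
  split_ifs <;> simp_all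

theorem mem_rootedForests_succ :
    T ∈ rootedForests (k + 1) R U ↔
      ∃ I ⊆ U, ∃ S ∈ parentEdgeSets R I, ∃ T' ∈ rootedForests k I (U \ I), S ∪ T' = T := by
  simp only [rootedForests, mem_biUnion, mem_powerset, mem_sups, sup_eq_union]

theorem subset_sym2_of_mem_rootedForests (hT : T ∈ rootedForests k R U) : T ⊆ (R ∪ U).sym2 := by
  induction k generalizing R U T with
  | zero => simp [(mem_rootedForests_zero.1 hT).2]
  | succ k ih =>
    obtain ⟨I, hIU, S, hS, T', hT', rfl⟩ := mem_rootedForests_succ.1 hT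
    obtain ⟨f, hf, rfl⟩ := mem_parentEdgeSets.1 hS
    refine union_subset (image_subset_iff.2 fun u _ => ?_) ((ih hT').trans ?_)
    · exact mk_mem_sym2_iff.2 ⟨mem_union_left _ (hf u), mem_union_right _ (hIU u.2)⟩
    · rw [union_sdiff_of_subset hIU]
      exact sym2_mono subset_union_right

theorem not_isDiag_of_mem_rootedForests (hRU : Disjoint R U) (hT : T ∈ rootedForests k R U)
    {e : Sym2 V} (he : e ∈ T) : ¬ e.IsDiag := by
  induction k generalizing R U T with
  | zero => simp [(mem_rootedForests_zero.1 hT).2] at he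
  | succ k ih =>
    obtain ⟨I, hIU, S, hS, T', hT', rfl⟩ := mem_rootedForests_succ.1 hT
    obtain ⟨f, hf, rfl⟩ := mem_parentEdgeSets.1 hS
    rcases mem_union.1 he with he | he
    · obtain ⟨u, -, rfl⟩ := mem_image.1 he
      exact fun hdiag => disjoint_left.1 hRU (hf u) (Sym2.mk_isDiag_iff.1 hdiag ▸ hIU u.2)
    · exact ih disjoint_sdiff hT' he

theorem exists_reachable_of_mem_rootedForests (hT : T ∈ rootedForests k R U) {u : V}
    (hu : u ∈ U) : ∃ r ∈ R, (SimpleGraph.fromEdgeSet (T : Set (Sym2 V))).Reachable r u := by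
  induction k generalizing R U T u with
  | zero => simp [(mem_rootedForests_zero.1 hT).1] at hu
  | succ k ih =>
    obtain ⟨I, -, S, hS, T', hT', rfl⟩ := mem_rootedForests_succ.1 hT
    obtain ⟨f, hf, rfl⟩ := mem_parentEdgeSets.1 hS
    set G := SimpleGraph.fromEdgeSet
      ((univ.image (fun u : I => s(f u, ↑u)) ∪ T' : Finset _) : Set (Sym2 V))
    have hparent : ∀ i : I, G.Reachable (f i) i := by
      intro i
      by_cases hi : f i = i
      · rw [hi]
      · refine SimpleGraph.Adj.reachable ((SimpleGraph.fromEdgeSet_adj _).2 ⟨?_, hi⟩)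
        exact mem_union_left _ (mem_image_of_mem (fun u : I => s(f u, ↑u)) (mem_univ i))
    by_cases huI : u ∈ I
    · exact ⟨f ⟨u, huI⟩, hf _, hparent ⟨u, huI⟩⟩
    · obtain ⟨i, hi, hreach⟩ := ih hT' (mem_sdiff.2 ⟨hu, huI⟩)
      refine ⟨f ⟨i, hi⟩, hf _, (hparent ⟨i, hi⟩).trans (hreach.mono ?_)⟩
      exact SimpleGraph.fromEdgeSet_mono (coe_subset.2 subset_union_right)

theorem notMem_of_mem_rootedForests (hRU : Disjoint R U) (hIU : I ⊆ U)
    (hT : T ∈ rootedForests k I (U \ I)) {e : Sym2 V} (he : e ∈ T) {r : V} (hr : r ∈ R) :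
    r ∉ e := by
  have hle := subset_sym2_of_mem_rootedForests hT he
  rw [union_sdiff_of_subset hIU, mem_sym2_iff] at hle
  exact fun hre => disjoint_left.1 hRU hr (hle r hre)

theorem exists_mem_of_mem_parentEdgeSets (hS : S ∈ parentEdgeSets R I) {e : Sym2 V} (he : e ∈ S) :
    ∃ r ∈ R, r ∈ e := by
  obtain ⟨f, hf, rfl⟩ := mem_parentEdgeSets.1 hS
  obtain ⟨u, -, rfl⟩ := mem_image.1 he
  exact ⟨f u, hf u, Sym2.mem_mk_left _ _⟩

theorem rootedForests_empty_right : rootedForests k R ∅ = {∅} := by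
  induction k generalizing R with
  | zero => simp [rootedForests]
  | succ k ih => simp [rootedForests, ih, parentEdgeSets]

theorem card_of_mem_rootedForests (hRU : Disjoint R U) (hT : T ∈ rootedForests k R U) :
    #T = #U := by
  induction k generalizing R U T with
  | zero => obtain ⟨rfl, rfl⟩ := mem_rootedForests_zero.1 hT; rfl
  | succ k ih =>
    obtain ⟨I, hIU, S, hS, T', hT', rfl⟩ := mem_rootedForests_succ.1 hT
    have hdisj : Disjoint S T' := disjoint_left.2 fun e heS heT' => by
      obtain ⟨r, hr, hre⟩ := exists_mem_of_mem_parentEdgeSets hS heS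
      exact notMem_of_mem_rootedForests hRU hIU hT' heT' hr hre
    rw [card_union_of_disjoint hdisj, card_of_mem_parentEdgeSets (hRU.mono_right hIU) hS,
      ih disjoint_sdiff hT', add_comm, card_sdiff_add_card_eq_card hIU]

theorem filter_mk_mem_union_eq (hRU : Disjoint R U) (hIU : I ⊆ U) (hS : S ∈ parentEdgeSets R I)
    (hT : T ∈ rootedForests k I (U \ I)) : {u ∈ U | ∃ r ∈ R, s(r, u) ∈ S ∪ T} = I := by
  obtain ⟨f, hf, rfl⟩ := mem_parentEdgeSets.1 hS
  have hfirst : ∀ r ∈ R, ∀ u, s(r, u) ∈ univ.image (fun u : I => s(f u, ↑u)) ∪ T ↔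
      ∃ hu : u ∈ I, f ⟨u, hu⟩ = r := fun r hr u => by
    rw [mem_union, mk_mem_image_mk_iff f (hRU.mono_right hIU) hr, or_iff_left]
    exact fun he => notMem_of_mem_rootedForests hRU hIU hT he hr (Sym2.mem_mk_left _ _)
  ext u
  rw [mem_filter]
  refine ⟨?_, fun hu => ⟨hIU hu, f ⟨u, hu⟩, hf _, (hfirst _ (hf _) u).2 ⟨hu, rfl⟩⟩⟩
  rintro ⟨-, r, hr, he⟩
  exact ((hfirst r hr u).1 he).1

theorem card_rootedForests_succ (hRU : Disjoint R U) :
    #(rootedForests (k + 1) R U) =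
      ∑ I ∈ U.powerset, #R ^ #I * #(rootedForests k I (U \ I)) := by
  rw [rootedForests, card_biUnion]
  · refine sum_congr rfl fun I hI => ?_
    rw [mem_powerset] at hI
    rw [card_sups_of_separated {e | ∃ r ∈ R, r ∈ e}, card_parentEdgeSets (hRU.mono_right hI)]
    · exact fun S hS e => exists_mem_of_mem_parentEdgeSets hS
    · rintro T hT e he ⟨r, hr, hre⟩
      exact notMem_of_mem_rootedForests hRU hI hT he hr hre
  · intro I hI J hJ hne
    rw [mem_coe, mem_powerset] at hI hJ
    refine disjoint_left.2 fun T hT hT' => hne ?_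
    obtain ⟨S₁, hS₁, T₁, hT₁, rfl⟩ := mem_sups.1 hT
    obtain ⟨S₂, hS₂, T₂, hT₂, heq⟩ := mem_sups.1 hT'
    rw [← filter_mk_mem_union_eq hRU hI hS₁ hT₁, ← filter_mk_mem_union_eq hRU hJ hS₂ hT₂]
    simp only [← sup_eq_union, heq]

theorem card_add_card_mul_card_rootedForests (hRU : Disjoint R U) (hk : R.Nonempty → #U ≤ k) :
    (#R + #U) * #(rootedForests k R U) = #R * (#R + #U) ^ #U := by
  induction k generalizing R U with
  | zero =>
    rcases R.eq_empty_or_nonempty with rfl | hR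
    · rcases U.eq_empty_or_nonempty with rfl | hU
      · simp
      · simp [rootedForests, hU.ne_empty]
    · have hU : U = ∅ := card_eq_zero.1 (Nat.le_zero.1 (hk hR))
      simp [rootedForests, hU]
  | succ k ih =>
    have hlayer : ∀ I ∈ U.powerset, #U * (#R ^ #I * #(rootedForests k I (U \ I))) =
        #I * #R ^ #I * #U ^ (#U - #I) := by
      intro I hI
      rw [mem_powerset] at hI
      rcases (#R ^ #I).eq_zero_or_pos with hzero | hpos
      · simp [hzero]
      · have hsize : I.Nonempty → #(U \ I) ≤ k := fun hIne => by
          have hR : R.Nonempty := by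
            rw [← card_pos]
            exact Nat.pos_of_ne_zero fun h => by simp [h, hIne.ne_empty] at hpos
          have := hk hR
          have := hIne.card_pos
          rw [card_sdiff_of_subset hI]
          lia
        have := ih (disjoint_sdiff (s := I) (t := U)) hsize
        rw [card_sdiff_of_subset hI, Nat.add_sub_cancel' (card_le_card hI)] at this
        linear_combination #R ^ #I * this
    rcases U.eq_empty_or_nonempty with rfl | hU
    · simp [rootedForests_empty_right]
    refine Nat.eq_of_mul_eq_mul_left hU.card_pos ?_
    calc #U * ((#R + #U) * #(rootedForests (k + 1) R U))
        = (#R + #U) * ∑ I ∈ U.powerset, #I * #R ^ #I * #U ^ (#U - #I) := by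
          rw [card_rootedForests_succ hRU, ← sum_congr rfl hlayer, ← mul_sum]; ring
      _ = #U * #R * (#R + #U) ^ #U := add_mul_sum_powerset_card_mul_pow_mul_pow _ _ U
      _ = #U * (#R * (#R + #U) ^ #U) := mul_assoc _ _ _

/-- The edge sets of the trees with vertex set `A`, enumerated as the forests on `A` with one
arbitrarily chosen root. -/
noncomputable def spanningTrees (A : Finset V) : Finset (Finset (Sym2 V)) :=
  if hA : A.Nonempty then rootedForests #A {hA.choose} (A.erase hA.choose) else ∅

theorem exists_root_of_mem_spanningTrees (hT : T ∈ spanningTrees A) :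
    ∃ r ∈ A, T ∈ rootedForests #A {r} (A.erase r) := by
  unfold spanningTrees at hT
  split_ifs at hT with hA
  · exact ⟨hA.choose, hA.choose_spec, hT⟩
  · simp at hT

theorem nonempty_of_mem_spanningTrees (hT : T ∈ spanningTrees A) : A.Nonempty :=
  (exists_root_of_mem_spanningTrees hT).imp fun _ => And.left

theorem subset_sym2_of_mem_spanningTrees (hT : T ∈ spanningTrees A) : T ⊆ A.sym2 := by
  obtain ⟨r, hr, hT⟩ := exists_root_of_mem_spanningTrees hT
  rw [← insert_erase hr, insert_eq]
  exact subset_sym2_of_mem_rootedForests hT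

theorem not_isDiag_of_mem_spanningTrees (hT : T ∈ spanningTrees A) {e : Sym2 V} (he : e ∈ T) :
    ¬ e.IsDiag := by
  obtain ⟨r, -, hT⟩ := exists_root_of_mem_spanningTrees hT
  exact not_isDiag_of_mem_rootedForests (by simp) hT he

theorem card_of_mem_spanningTrees (hT : T ∈ spanningTrees A) : #T = #A - 1 := by
  obtain ⟨r, hr, hT⟩ := exists_root_of_mem_spanningTrees hT
  rw [card_of_mem_rootedForests (by simp) hT, card_erase_of_mem hr]

theorem reachable_of_mem_spanningTrees (hT : T ∈ spanningTrees A) {u v : V} (hu : u ∈ A)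
    (hv : v ∈ A) : (SimpleGraph.fromEdgeSet (T : Set (Sym2 V))).Reachable u v := by
  obtain ⟨r, -, hT⟩ := exists_root_of_mem_spanningTrees hT
  have hroot : ∀ w ∈ A, (SimpleGraph.fromEdgeSet (T : Set (Sym2 V))).Reachable r w := by
    intro w hw
    by_cases hwr : w = r
    · rw [hwr]
    · obtain ⟨r', hr', hreach⟩ :=
        exists_reachable_of_mem_rootedForests hT (mem_erase.2 ⟨hwr, hw⟩)
      rwa [mem_singleton.1 hr'] at hreach
  exact (hroot u hu).symm.trans (hroot v hv)

theorem card_spanningTrees (hA : A.Nonempty) : #(spanningTrees A) = #A ^ (#A - 2) := by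
  have hpos : 1 ≤ #A := hA.card_pos
  have hcount := card_add_card_mul_card_rootedForests (k := #A)
    (disjoint_singleton_left.2 (notMem_erase hA.choose A)) fun _ => card_erase_le
  rw [card_singleton, card_erase_of_mem hA.choose_spec, Nat.add_sub_cancel' hpos, one_mul]
    at hcount
  rw [spanningTrees, dif_pos hA]
  refine Nat.eq_of_mul_eq_mul_left hpos (hcount.trans ?_)
  rcases hpos.eq_or_lt with h | h
  · simp [← h]
  · rw [← pow_succ']
    congr 1
    lia

theorem disjoint_sym2 {α : Type*} {A B : Finset α} (hAB : Disjoint A B) :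
    Disjoint A.sym2 B.sym2 :=
  disjoint_left.2 fun e heA heB => disjoint_left.1 hAB
    (mem_sym2_iff.1 heA _ (Sym2.out_fst_mem e)) (mem_sym2_iff.1 heB _ (Sym2.out_fst_mem e))

theorem card_of_mem_sups_spanningTrees (hAB : Disjoint A B) {U : Finset (Sym2 V)}
    (hU : U ∈ spanningTrees A ⊻ spanningTrees B) : #U = #A - 1 + (#B - 1) := by
  obtain ⟨S, hS, T, hT, rfl⟩ := mem_sups.1 hU
  have hST : Disjoint S T := (disjoint_sym2 hAB).mono (subset_sym2_of_mem_spanningTrees hS)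
    (subset_sym2_of_mem_spanningTrees hT)
  rw [sup_eq_union, card_union_of_disjoint hST, card_of_mem_spanningTrees hS,
    card_of_mem_spanningTrees hT]

theorem card_sups_spanningTrees (hA : A.Nonempty) (hB : B.Nonempty) (hAB : Disjoint A B) :
    #(spanningTrees A ⊻ spanningTrees B) = #A ^ (#A - 2) * #B ^ (#B - 2) := by
  rw [card_sups_of_separated (A.sym2 : Set (Sym2 V)), card_spanningTrees hA, card_spanningTrees hB]
  · exact fun S hS e he => subset_sym2_of_mem_spanningTrees hS he
  · exact fun T hT e he =>
      disjoint_right.1 (disjoint_sym2 hAB) (subset_sym2_of_mem_spanningTrees hT he)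

end RootedForest

section TreeComponent

open scoped FinsetFamily

variable {V : Type*} [Fintype V] [DecidableEq V] {G : SimpleGraph V} {A B : Finset V}
  {p : unitInterval}

/-- The pairs of distinct vertices that have at least one vertex in `A`, that is, the potential
edges which decide whether `A` is a component. -/
def incidentPairs (A : Finset V) : Finset (Sym2 V) :=
  {e | ¬ e.IsDiag ∧ ∃ a ∈ A, a ∈ e}

theorem mem_incidentPairs {e : Sym2 V} :
    e ∈ incidentPairs A ↔ ¬ e.IsDiag ∧ ∃ a ∈ A, a ∈ e := by
  simp [incidentPairs]

theorem incidentPairs_union : incidentPairs (A ∪ B) = incidentPairs A ∪ incidentPairs B := by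
  ext e
  simp only [mem_union, mem_incidentPairs]
  grind

theorem incidentPairs_subset_compl_diagSet :
    (incidentPairs A : Set (Sym2 V)) ⊆ Sym2.diagSetᶜ :=
  fun _ he => (mem_incidentPairs.1 he).1

theorem add_choose_two (j k : ℕ) : (j + k).choose 2 = j.choose 2 + k.choose 2 + j * k := by
  induction k with
  | zero => simp
  | succ k ih =>
    rw [← add_assoc, Nat.choose_succ_left _ _ two_pos, ih, Nat.choose_succ_left k _ two_pos]
    simp
    ring

theorem card_filter_sym2_not_isDiag {α : Type*} [DecidableEq α] (S : Finset α) :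
    #{e ∈ S.sym2 | ¬ e.IsDiag} = (#S).choose 2 := by
  rw [sym2_eq_image]
  exact (congrArg card (Sym2.filter_image_mk_not_isDiag S)).trans (Sym2.card_image_offDiag S)

theorem card_incidentPairs (A : Finset V) :
    #(incidentPairs A) = (#A).choose 2 + #A * (Fintype.card V - #A) := by
  have hcompl : incidentPairs A =
      ({e ∈ (univ : Finset V).sym2 | ¬ e.IsDiag} : Finset (Sym2 V)) \
        ({e ∈ Aᶜ.sym2 | ¬ e.IsDiag} : Finset (Sym2 V)) := by
    ext e
    grind [mem_incidentPairs, mem_compl]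
  have hcard := add_choose_two #A #Aᶜ
  rw [card_add_card_compl] at hcard
  rw [hcompl, card_sdiff_of_subset (filter_subset_filter _ (sym2_mono (subset_univ _))),
    card_filter_sym2_not_isDiag, card_filter_sym2_not_isDiag, card_univ, ← card_compl]
  lia

theorem subset_incidentPairs_of_mem_spanningTrees {T : Finset (Sym2 V)}
    (hT : T ∈ spanningTrees A) : T ⊆ incidentPairs A := by
  intro e he
  have hA := mem_sym2_iff.1 (subset_sym2_of_mem_spanningTrees hT he)
  exact mem_incidentPairs.2 ⟨not_isDiag_of_mem_spanningTrees hT he, _,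
    hA _ (Sym2.out_fst_mem e), Sym2.out_fst_mem e⟩

theorem disjoint_incidentPairs_of_mem_spanningTrees (hAB : Disjoint A B) {T : Finset (Sym2 V)}
    (hT : T ∈ spanningTrees B) : Disjoint T (incidentPairs A) := by
  refine disjoint_left.2 fun e he heA => ?_
  obtain ⟨a, ha, hae⟩ := (mem_incidentPairs.1 heA).2
  exact disjoint_left.1 hAB ha
    (mem_sym2_iff.1 (subset_sym2_of_mem_spanningTrees hT he) a hae)

/-- `A` is the vertex set of a connected component of `G` and this component is a tree. It is
expressed by the edges of `G` that meet `A`, so that its probability is that of a cylinder. -/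
def IsTreeComponent (G : SimpleGraph V) (A : Finset V) : Prop :=
  ∃ T ∈ spanningTrees A, G.edgeSet ∩ incidentPairs A = T

theorem IsTreeComponent.exists_supp_eq (hA : IsTreeComponent G A) :
    ∃ c : G.ConnectedComponent, c.supp = A := by
  obtain ⟨T, hT, hGT⟩ := hA
  obtain ⟨a, ha⟩ := nonempty_of_mem_spanningTrees hT
  have hTG : SimpleGraph.fromEdgeSet (T : Set (Sym2 V)) ≤ G := by
    rw [← hGT]
    exact (SimpleGraph.fromEdgeSet_mono Set.inter_subset_left).trans_eq G.fromEdgeSet_edgeSet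
  refine ⟨G.connectedComponentMk a, ?_⟩
  ext x
  rw [SimpleGraph.ConnectedComponent.mem_supp_iff, SimpleGraph.ConnectedComponent.eq, mem_coe]
  refine ⟨fun hx => ?_, fun hx => (reachable_of_mem_spanningTrees hT hx ha).mono hTG⟩
  by_contra hxA
  obtain ⟨w⟩ := hx.symm
  obtain ⟨d, -, hfst, hsnd⟩ := w.exists_boundary_dart (A : Set V) ha hxA
  have hedge : s(d.fst, d.snd) ∈ (T : Set (Sym2 V)) :=
    hGT ▸ ⟨d.adj, mem_incidentPairs.2 ⟨fun h => d.adj.ne (Sym2.mk_isDiag_iff.1 h), _, hfst,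
      Sym2.mem_mk_left _ _⟩⟩
  exact hsnd (mk_mem_sym2_iff.1 (subset_sym2_of_mem_spanningTrees hT hedge)).2

theorem IsTreeComponent.disjoint (hA : IsTreeComponent G A) (hB : IsTreeComponent G B)
    (hne : A ≠ B) : Disjoint A B := by
  obtain ⟨c, hc⟩ := hA.exists_supp_eq
  obtain ⟨d, hd⟩ := hB.exists_supp_eq
  rw [← disjoint_coe, ← hc, ← hd]
  refine SimpleGraph.pairwise_disjoint_supp_connectedComponent G fun hcd => hne ?_
  rw [← coe_inj, ← hc, ← hd, hcd]

theorem sum_indicator_isTreeComponent_le {W : Finset ℕ} {b : ℝ}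
    (hW : ∀ k ∈ W, b ≤ k ∧ (k : ℝ) ≤ 2 * b) (G : SimpleGraph V) :
    ∑ A : Finset V with #A ∈ W, {G | IsTreeComponent G A}.indicator (1 : SimpleGraph V → ℝ) G ≤
      (componentsInWindow G b).ncard := by
  classical
  have hsupp : (↑) '' {A : Finset V | #A ∈ W ∧ IsTreeComponent G A} ⊆
      SimpleGraph.ConnectedComponent.supp '' componentsInWindow G b := by
    rintro _ ⟨A, ⟨hAW, hA⟩, rfl⟩
    obtain ⟨c, hc⟩ := hA.exists_supp_eq
    refine ⟨c, ?_, hc⟩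
    rw [componentsInWindow, Set.mem_ofPred_eq, componentSize, hc, Set.ncard_coe_finset]
    exact hW _ hAW
  have hcount : #{A : Finset V | #A ∈ W ∧ IsTreeComponent G A} ≤ (componentsInWindow G b).ncard :=
    calc #{A : Finset V | #A ∈ W ∧ IsTreeComponent G A}
        = ((↑) '' {A : Finset V | #A ∈ W ∧ IsTreeComponent G A} : Set (Set V)).ncard := by
          rw [Set.ncard_image_of_injective _ coe_injective, ← Set.ncard_coe_finset, coe_filter_univ]
      _ ≤ _ := Set.ncard_le_ncard hsupp
      _ ≤ _ := Set.ncard_image_le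
  simp only [Set.indicator_apply, Set.mem_ofPred_eq, Pi.one_apply]
  rw [← sum_filter, filter_filter, sum_const, nsmul_one]
  exact_mod_cast hcount

/-- The probability that `k` given vertices out of `n` form a tree component, when every edge has
probability `p`. -/
noncomputable def treeComponentProb (p : ℝ) (n k : ℕ) : ℝ :=
  k ^ (k - 2) * (p ^ (k - 1) * (1 - p) ^ ((k - 1).choose 2 + k * (n - k)))

theorem treeComponentProb_nonneg {p : ℝ} (hp0 : 0 ≤ p) (hp1 : p ≤ 1) (n k : ℕ) :
    0 ≤ treeComponentProb p n k := by
  have : 0 ≤ 1 - p := sub_nonneg.2 hp1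
  unfold treeComponentProb
  positivity

theorem choose_two_sub_pred {k : ℕ} (hk : k ≠ 0) : k.choose 2 = (k - 1).choose 2 + (k - 1) := by
  obtain ⟨k, rfl⟩ := Nat.exists_eq_succ_of_ne_zero hk
  simpa using add_choose_two k 1

theorem binomialRandom_real_isTreeComponent (hA : A.Nonempty) :
    (SimpleGraph.binomialRandom V p).real {G | IsTreeComponent G A} =
      treeComponentProb p (Fintype.card V) #A := by
  have hexp : #(incidentPairs A) - (#A - 1) =
      (#A - 1).choose 2 + #A * (Fintype.card V - #A) := by
    rw [card_incidentPairs, choose_two_sub_pred hA.card_ne_zero]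
    lia
  unfold IsTreeComponent
  rw [binomialRandom_real_exists_edgeSet_inter_eq incidentPairs_subset_compl_diagSet
    (fun T => subset_incidentPairs_of_mem_spanningTrees) fun T => card_of_mem_spanningTrees,
    card_spanningTrees hA, hexp, treeComponentProb, Nat.cast_pow]

theorem isTreeComponent_and_iff (hAB : Disjoint A B) :
    IsTreeComponent G A ∧ IsTreeComponent G B ↔
      ∃ T ∈ spanningTrees A ⊻ spanningTrees B, G.edgeSet ∩ incidentPairs (A ∪ B) = T := by
  rw [incidentPairs_union, coe_union, Set.inter_union_distrib_left]
  constructor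
  · rintro ⟨⟨S, hS, hGS⟩, T, hT, hGT⟩
    refine ⟨S ∪ T, mem_sups.2 ⟨S, hS, T, hT, rfl⟩, ?_⟩
    rw [coe_union, hGS, hGT]
  · rintro ⟨_, hU, hG⟩
    obtain ⟨S, hS, T, hT, rfl⟩ := mem_sups.1 hU
    have hSA := @subset_incidentPairs_of_mem_spanningTrees _ _ _ _ _ hS
    have hSB := disjoint_left.1 (disjoint_incidentPairs_of_mem_spanningTrees hAB.symm hS)
    have hTB := @subset_incidentPairs_of_mem_spanningTrees _ _ _ _ _ hT
    have hTA := disjoint_left.1 (disjoint_incidentPairs_of_mem_spanningTrees hAB hT)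
    simp only [Set.ext_iff, Set.mem_union, Set.mem_inter_iff, mem_coe, sup_eq_union, mem_union]
      at hG
    refine ⟨⟨S, hS, Set.ext fun e => ?_⟩, T, hT, Set.ext fun e => ?_⟩
    · grind [hG e, @hSA e, @hSB e, @hTB e, @hTA e]
    · grind [hG e, @hSA e, @hSB e, @hTB e, @hTA e]

theorem card_incidentPairs_union_sub_add (hA : A.Nonempty) (hB : B.Nonempty)
    (hAB : Disjoint A B) :
    #(incidentPairs (A ∪ B)) - (#A - 1 + (#B - 1)) + #A * #B =
      ((#A - 1).choose 2 + #A * (Fintype.card V - #A)) +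
        ((#B - 1).choose 2 + #B * (Fintype.card V - #B)) := by
  obtain ⟨m, hm⟩ := Nat.exists_eq_add_of_le (card_le_univ (A ∪ B))
  rw [card_union_of_disjoint hAB] at hm
  have hmA : #A + #B + m - #A = #B + m := by lia
  have hmB : #A + #B + m - #B = #A + m := by lia
  rw [card_incidentPairs, card_union_of_disjoint hAB, hm, hmA, hmB, add_choose_two,
    choose_two_sub_pred hA.card_ne_zero, choose_two_sub_pred hB.card_ne_zero,
    Nat.add_sub_cancel_left]
  lia

theorem binomialRandom_real_isTreeComponent_inter (hA : A.Nonempty) (hB : B.Nonempty)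
    (hAB : Disjoint A B) :
    (SimpleGraph.binomialRandom V p).real
        ({G | IsTreeComponent G A} ∩ {G | IsTreeComponent G B}) * (1 - p) ^ (#A * #B) =
      treeComponentProb p (Fintype.card V) #A * treeComponentProb p (Fintype.card V) #B := by
  have hevent : {G : SimpleGraph V | IsTreeComponent G A} ∩ {G | IsTreeComponent G B} =
      {G | ∃ T ∈ spanningTrees A ⊻ spanningTrees B,
        G.edgeSet ∩ (incidentPairs (A ∪ B) : Set (Sym2 V)) = T} :=
    Set.ext fun G => isTreeComponent_and_iff hAB
  have hsub : ∀ U ∈ spanningTrees A ⊻ spanningTrees B, U ⊆ incidentPairs (A ∪ B) := by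
    intro U hU
    obtain ⟨S, hS, T, hT, rfl⟩ := mem_sups.1 hU
    rw [incidentPairs_union]
    exact union_subset_union (subset_incidentPairs_of_mem_spanningTrees hS)
      (subset_incidentPairs_of_mem_spanningTrees hT)
  rw [hevent, binomialRandom_real_exists_edgeSet_inter_eq incidentPairs_subset_compl_diagSet
    hsub (fun U => card_of_mem_sups_spanningTrees hAB), card_sups_spanningTrees hA hB hAB,
    treeComponentProb, treeComponentProb, mul_assoc, mul_assoc, ← pow_add,
    card_incidentPairs_union_sub_add hA hB hAB, pow_add, pow_add]
  push_cast
  ring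

theorem sum_filter_card_mem {α : Type*} (S : Finset α) (W : Finset ℕ) (f : ℕ → ℝ) :
    ∑ A ∈ S.powerset with #A ∈ W, f #A = ∑ k ∈ W, (#S).choose k * f k := by
  have hvanish : ∀ k ∈ W, k ∉ {k ∈ range (#S + 1) | k ∈ W} → (#S).choose k * f k = 0 := by
    intro k hkW hk
    rw [Nat.choose_eq_zero_of_lt (by grind), Nat.cast_zero, zero_mul]
  rw [sum_filter, sum_powerset_apply_card (fun k => if k ∈ W then f k else 0)]
  simp only [smul_ite, smul_zero, nsmul_eq_mul]
  rw [← sum_filter]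
  exact sum_subset (fun k hk => (mem_filter.1 hk).2) hvanish

theorem measurableSet_isTreeComponent :
    MeasurableSet {G : SimpleGraph V | IsTreeComponent G A} := by
  simp only [IsTreeComponent, ← exists_prop, Set.ofPred_exists]
  exact .biUnion (Set.to_countable _) fun T _ => measurableSet_edgeSet_inter_eq _ _

theorem sum_binomialRandom_real_isTreeComponent {W : Finset ℕ} (hW : 0 ∉ W) :
    ∑ A : Finset V with #A ∈ W, (SimpleGraph.binomialRandom V p).real {G | IsTreeComponent G A} =
      ∑ k ∈ W, (Fintype.card V).choose k * treeComponentProb p (Fintype.card V) k := by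
  rw [← card_univ, ← sum_filter_card_mem univ W fun k => treeComponentProb p #(univ : Finset V) k,
    powerset_univ]
  refine sum_congr rfl fun A hA => binomialRandom_real_isTreeComponent (card_ne_zero.1 fun h => ?_)
  exact hW (h ▸ (mem_filter.1 hA).2)

/-- Only the sets disjoint from `A` contribute, and `A` leaves them `card V - #A` vertices. -/
theorem sum_binomialRandom_real_isTreeComponent_inter (hA : A.Nonempty) {W : Finset ℕ}
    (hW : 0 ∉ W) (hp : (p : ℝ) < 1) :
    ∑ B ∈ ({B : Finset V | #B ∈ W} : Finset (Finset V)).erase A,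
        (SimpleGraph.binomialRandom V p).real
          ({G | IsTreeComponent G A} ∩ {G | IsTreeComponent G B}) =
      ∑ k ∈ W, (Fintype.card V - #A).choose k *
        (treeComponentProb p (Fintype.card V) #A * treeComponentProb p (Fintype.card V) k /
          (1 - p) ^ (#A * k)) := by
  have hsub : {B ∈ Aᶜ.powerset | #B ∈ W} ⊆
      ({B : Finset V | #B ∈ W} : Finset (Finset V)).erase A := by
    intro B hB
    obtain ⟨hBA, hBW⟩ := mem_filter.1 hB
    refine mem_erase.2 ⟨?_, mem_filter.2 ⟨mem_univ B, hBW⟩⟩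
    rintro rfl
    exact hA.ne_empty (disjoint_self.1 (subset_compl_iff_disjoint_right.1 (mem_powerset.1 hBA)))
  rw [← card_compl, ← sum_filter_card_mem Aᶜ W fun k => treeComponentProb p (Fintype.card V) #A *
    treeComponentProb p (Fintype.card V) k / (1 - p) ^ (#A * k), ← sum_subset hsub]
  · refine sum_congr rfl fun B hB => ?_
    obtain ⟨hBA, hBW⟩ := mem_filter.1 hB
    have hB : B.Nonempty := card_ne_zero.1 fun h => hW (h ▸ hBW)
    have hAB : Disjoint A B := (subset_compl_iff_disjoint_right.1 (mem_powerset.1 hBA)).symm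
    rw [eq_div_iff (pow_ne_zero _ (sub_ne_zero.2 hp.ne')),
      binomialRandom_real_isTreeComponent_inter hA hB hAB]
  · intro B hB hBA
    have hempty : {G : SimpleGraph V | IsTreeComponent G A} ∩ {G | IsTreeComponent G B} = ∅ := by
      refine Set.eq_empty_of_forall_notMem fun G hG => hBA (mem_filter.2 ⟨mem_powerset.2 ?_, ?_⟩)
      · exact subset_compl_iff_disjoint_right.2 (hG.2.disjoint hG.1 (mem_erase.1 hB).1)
      · exact (mem_filter.1 (mem_erase.1 hB).2).2
    rw [hempty, measureReal_empty]

theorem sum_binomialRandom_real_isTreeComponent_inter_le {W : Finset ℕ} {x : ℝ} (hA : A.Nonempty)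
    (hW : 0 ∉ W) (hp : (p : ℝ) < 1)
    (hx : ∀ k ∈ W, ((Fintype.card V - #A).choose k : ℝ) ≤
      (1 + x) * (1 - p) ^ (#A * k) * (Fintype.card V).choose k) :
    ∑ B ∈ ({B : Finset V | #B ∈ W} : Finset (Finset V)).erase A,
        (SimpleGraph.binomialRandom V p).real
          ({G | IsTreeComponent G A} ∩ {G | IsTreeComponent G B}) ≤
      (SimpleGraph.binomialRandom V p).real {G | IsTreeComponent G A} *
        ((1 + x) * ∑ k ∈ W, (Fintype.card V).choose k *
          treeComponentProb p (Fintype.card V) k) := by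
  set n := Fintype.card V
  set t := treeComponentProb p n
  have hq : 0 < 1 - (p : ℝ) := sub_pos.2 hp
  have ht : ∀ k, 0 ≤ t k := treeComponentProb_nonneg p.2.1 p.2.2 n
  rw [sum_binomialRandom_real_isTreeComponent_inter hA hW hp,
    binomialRandom_real_isTreeComponent hA, mul_sum, mul_sum]
  refine sum_le_sum fun k hk => ?_
  calc ((n - #A).choose k : ℝ) * (t #A * t k / (1 - p) ^ (#A * k))
      ≤ (1 + x) * (1 - p) ^ (#A * k) * n.choose k * (t #A * t k / (1 - p) ^ (#A * k)) := by
        have := ht #A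
        have := ht k
        gcongr
        exact hx k hk
    _ = t #A * ((1 + x) * (n.choose k * t k)) := by field_simp

omit [DecidableEq V] in
theorem binomialRandom_real_ncard_componentsInWindow_le_half {W : Finset ℕ} {b x M : ℝ}
    (hb : 0 < b) (hW : ∀ k ∈ W, b ≤ k ∧ (k : ℝ) ≤ 2 * b) (hp : (p : ℝ) < 1) (hM0 : 0 < M)
    (hM : ∑ k ∈ W, (Fintype.card V).choose k * treeComponentProb p (Fintype.card V) k = M)
    (hx : ∀ j ∈ W, ∀ k ∈ W, ((Fintype.card V - j).choose k : ℝ) ≤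
      (1 + x) * (1 - p) ^ (j * k) * (Fintype.card V).choose k) :
    (SimpleGraph.binomialRandom V p).real {G | ((componentsInWindow G b).ncard : ℝ) ≤ M / 2} ≤
      4 * (1 / M + x) := by
  classical
  have hW0 : 0 ∉ W := fun h => by simpa using hb.trans_le (hW 0 h).1
  have hmean := (sum_binomialRandom_real_isTreeComponent hW0).trans hM
  have hpair : ∀ A : Finset V, #A ∈ W →
      ∑ B ∈ ({B : Finset V | #B ∈ W} : Finset (Finset V)).erase A,
        (SimpleGraph.binomialRandom V p).real
          ({G | IsTreeComponent G A} ∩ {G | IsTreeComponent G B}) ≤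
        (SimpleGraph.binomialRandom V p).real {G | IsTreeComponent G A} * ((1 + x) * M) :=
    fun A hAW => hM ▸ sum_binomialRandom_real_isTreeComponent_inter_le
      (card_ne_zero.1 fun h => hW0 (h ▸ hAW)) hW0 hp (hx _ hAW)
  refine (measureReal_mono fun G hG => ?_).trans (measureReal_sum_indicator_le_half
    (fun A _ => measurableSet_isTreeComponent) hmean hM0 ?_)
  · exact (sum_indicator_isTreeComponent_le hW G).trans hG
  · calc _ ≤ _ := sum_le_sum fun A hA => hpair A (mem_filter.1 hA).2
      _ = (1 + x) * M ^ 2 := by rw [← sum_mul, hmean]; ring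

end TreeComponent

section Estimates

open Real

theorem exp_neg_sub_two_mul_sq_le {x : ℝ} (hx : x ≤ 1 / 2) : exp (-x - 2 * x ^ 2) ≤ 1 - x := by
  have h0 : 0 < 1 - x := by linarith
  have hquot : x ^ 2 / (1 - x) ≤ 2 * x ^ 2 := by
    rw [div_le_iff₀ h0]
    nlinarith [sq_nonneg x]
  rw [← le_log_iff_exp_le h0]
  calc -x - 2 * x ^ 2 ≤ -x - x ^ 2 / (1 - x) := by gcongr
    _ = 1 - (1 - x)⁻¹ := by field_simp; ring
    _ ≤ log (1 - x) := one_sub_inv_le_log_of_pos h0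

theorem exp_neg_mul_le_one_sub_pow {x : ℝ} (hx : x ≤ 1 / 2) (m : ℕ) :
    exp (-((x + 2 * x ^ 2) * m)) ≤ (1 - x) ^ m :=
  calc exp (-((x + 2 * x ^ 2) * m)) = exp (-x - 2 * x ^ 2) ^ m := by
        rw [← exp_nat_mul]; ring_nf
    _ ≤ (1 - x) ^ m := pow_le_pow_left₀ (exp_nonneg _) (exp_neg_sub_two_mul_sq_le hx) m

theorem exp_le_one_add_two_mul {y : ℝ} (h0 : 0 ≤ y) (h1 : y ≤ 1 / 2) : exp y ≤ 1 + 2 * y :=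
  calc exp y ≤ 1 / (1 - y) := exp_bound_div_one_sub_of_interval h0 (by linarith)
    _ ≤ 1 + 2 * y := by
        rw [div_le_iff₀ (by linarith)]
        nlinarith

theorem factorial_le_exp_one_mul {k : ℕ} (hk : k ≠ 0) :
    (k.factorial : ℝ) ≤ exp 1 * √k * (k / exp 1) ^ k := by
  obtain ⟨k, rfl⟩ := Nat.exists_eq_add_one_of_ne_zero hk
  have hanti := Stirling.stirlingSeq'_antitone (Nat.zero_le k)
  simp only [Function.comp_apply, Nat.succ_eq_add_one, zero_add, Stirling.stirlingSeq_one] at hanti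
  rw [Stirling.stirlingSeq, div_le_div_iff₀ (by positivity) (by positivity),
    sqrt_mul zero_le_two] at hanti
  refine le_of_mul_le_mul_right ?_ (sqrt_pos.2 zero_lt_two)
  exact hanti.trans_eq (by ring)

theorem descFactorial_sub_le (n j k : ℕ) :
    ((n - j).descFactorial k : ℝ) ≤ n.descFactorial k * exp (-(j * k / n)) := by
  have hfactor : ∀ i : ℕ, ((n - j - i : ℕ) : ℝ) ≤ (n - i : ℕ) * exp (-(j / n)) := by
    intro i
    rcases le_or_gt (n - j) i with hi | hi
    · rw [Nat.sub_eq_zero_of_le hi, Nat.cast_zero]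
      positivity
    have hn : (0 : ℝ) < n := by exact_mod_cast (by lia : 0 < n)
    calc ((n - j - i : ℕ) : ℝ) = n - i - j := by
          rw [Nat.sub_sub, Nat.cast_sub (by lia)]
          push_cast
          ring
      _ ≤ n - i - j + i * j / n := le_add_of_nonneg_right (by positivity)
      _ = (n - i : ℕ) * (1 - j / n) := by
          rw [Nat.cast_sub (by lia)]
          field_simp
          ring
      _ ≤ (n - i : ℕ) * exp (-(j / n)) := by
          gcongr
          exact one_sub_le_exp_neg _
  induction k with
  | zero => simp
  | succ k ih =>
    rw [Nat.descFactorial_succ, Nat.descFactorial_succ, Nat.cast_mul, Nat.cast_mul]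
    calc _ ≤ ((n - k : ℕ) * exp (-(j / n))) * (n.descFactorial k * exp (-(j * k / n))) := by
          gcongr
          exact hfactor k
      _ = (n - k : ℕ) * n.descFactorial k * (exp (-(j / n)) * exp (-(j * k / n))) := by ring
      _ = _ := by
          rw [← exp_add]
          push_cast
          ring_nf

theorem choose_sub_le (n j k : ℕ) :
    ((n - j).choose k : ℝ) ≤ n.choose k * exp (-(j * k / n)) := by
  have hk : (0 : ℝ) < k.factorial := by exact_mod_cast k.factorial_pos
  refine le_of_mul_le_mul_left ?_ hk
  rw [← mul_assoc]
  exact_mod_cast Nat.descFactorial_eq_factorial_mul_choose n k ▸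
    Nat.descFactorial_eq_factorial_mul_choose (n - j) k ▸ descFactorial_sub_le n j k

theorem pow_mul_exp_le_descFactorial {n k : ℕ} (h : 2 * k ≤ n) :
    (n : ℝ) ^ k * exp (-(k ^ 2 / (2 * n) + 2 * k ^ 3 / n ^ 2)) ≤ n.descFactorial k := by
  induction k with
  | zero => simp
  | succ k ih =>
    have hn : (0 : ℝ) < n := by exact_mod_cast (by lia : 0 < n)
    have hk : (k : ℝ) / n ≤ 1 / 2 := by
      rw [div_le_div_iff₀ hn two_pos]
      exact_mod_cast (by lia : k * 2 ≤ 1 * n)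
    have hfactor : (n : ℝ) * exp (-(k / n) - 2 * (k / n) ^ 2) ≤ (n - k : ℕ) := by
      rw [Nat.cast_sub (by lia)]
      calc (n : ℝ) * exp (-(k / n) - 2 * (k / n) ^ 2) ≤ n * (1 - k / n) := by
            gcongr
            exact exp_neg_sub_two_mul_sq_le hk
        _ = n - k := by field_simp
    have hexponent : -(((k + 1 : ℕ) : ℝ) ^ 2 / (2 * n) + 2 * ((k + 1 : ℕ) : ℝ) ^ 3 / n ^ 2) ≤
        -(k / n) - 2 * (k / n) ^ 2 + -(k ^ 2 / (2 * n) + 2 * k ^ 3 / n ^ 2) := by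
      rw [← sub_nonneg]
      calc (0 : ℝ) ≤ 1 / (2 * n) + (4 * k ^ 2 + 6 * k + 2) / n ^ 2 := by positivity
        _ = _ := by
            push_cast
            field_simp
            ring
    rw [Nat.descFactorial_succ, Nat.cast_mul]
    calc _ ≤ (n : ℝ) ^ (k + 1) * exp (-(k / n) - 2 * (k / n) ^ 2 +
          -(k ^ 2 / (2 * n) + 2 * k ^ 3 / n ^ 2)) := by gcongr
      _ = (n * exp (-(k / n) - 2 * (k / n) ^ 2)) *
          (n ^ k * exp (-(k ^ 2 / (2 * n) + 2 * k ^ 3 / n ^ 2))) := by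
          rw [exp_add]
          ring
      _ ≤ (n - k : ℕ) * n.descFactorial k :=
          mul_le_mul hfactor (ih (by lia)) (by positivity) (by positivity)

theorem pow_mul_exp_le_choose_mul {n k : ℕ} (hk : k ≠ 0) (h : 2 * k ≤ n) :
    (n : ℝ) ^ k * exp (k - 1 - (k ^ 2 / (2 * n) + 2 * k ^ 3 / n ^ 2)) ≤
      n.choose k * (k ^ k * √k) := by
  have hexp : exp (k - 1 : ℝ) * (exp 1 * √k * (k / exp 1) ^ k) = k ^ k * √k := by
    rw [div_pow, ← exp_nat_mul, exp_sub, mul_one]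
    field_simp
  calc (n : ℝ) ^ k * exp (k - 1 - (k ^ 2 / (2 * n) + 2 * k ^ 3 / n ^ 2))
      = exp (k - 1) * (n ^ k * exp (-(k ^ 2 / (2 * n) + 2 * k ^ 3 / n ^ 2))) := by
        rw [sub_eq_add_neg, exp_add]
        ring
    _ ≤ exp (k - 1) * n.descFactorial k := by
        gcongr
        exact pow_mul_exp_le_descFactorial h
    _ = exp (k - 1) * k.factorial * n.choose k := by
        rw [Nat.descFactorial_eq_factorial_mul_choose, Nat.cast_mul, mul_assoc]
    _ ≤ exp (k - 1) * (exp 1 * √k * (k / exp 1) ^ k) * n.choose k := by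
        gcongr
        exact factorial_le_exp_one_mul hk
    _ = n.choose k * (k ^ k * √k) := by rw [hexp, mul_comm]

theorem exp_le_pow_mul_one_sub_pow {n k : ℕ} {p ε : ℝ} (hk : k ≠ 0) (hkn : k ≤ n)
    (hε : -(1 / 2) ≤ ε) (hp0 : 0 ≤ p) (hp : p ≤ 1 / 2) :
    exp ((ε - 2 * ε ^ 2) * (k - 1) - (p + 2 * p ^ 2) * (k * n - k ^ 2 / 2)) ≤
      (1 + ε) ^ (k - 1) * (1 - p) ^ ((k - 1).choose 2 + k * (n - k)) := by
  have hk1 : 1 ≤ k := Nat.one_le_iff_ne_zero.2 hk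
  have hexponent : (((k - 1).choose 2 + k * (n - k) : ℕ) : ℝ) ≤ k * n - k ^ 2 / 2 := by
    have : (1 : ℝ) ≤ k := by exact_mod_cast hk1
    push_cast [Nat.cast_choose_two, Nat.cast_sub hk1, Nat.cast_sub hkn]
    nlinarith
  have hedges : exp ((ε - 2 * ε ^ 2) * (k - 1)) ≤ (1 + ε) ^ (k - 1) := by
    convert exp_neg_mul_le_one_sub_pow (x := -ε) (by linarith) (k - 1) using 1
    · push_cast [Nat.cast_sub hk1]
      ring_nf
    · rw [sub_neg_eq_add]
  have hnonedges : exp (-((p + 2 * p ^ 2) * (k * n - k ^ 2 / 2))) ≤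
      (1 - p) ^ ((k - 1).choose 2 + k * (n - k)) :=
    le_trans (by gcongr) (exp_neg_mul_le_one_sub_pow hp _)
  rw [sub_eq_add_neg, exp_add]
  have : 0 ≤ 1 + ε := by linarith
  gcongr

/-- The terms of order `k`, `ε k` and `k ^ 2 / n` cancel between the binomial coefficient, the edges
and the non-edges; the critical window is where the remaining ones are bounded. -/
theorem neg_twentyEight_le_exponent {n k p ε : ℝ} (hn : 0 < n) (hk : 1 ≤ k) (h2k : 2 * k ≤ n)
    (hp : p * n = 1 + ε) (hε : |ε| ≤ 1 / 2) (hkε : k * ε ^ 2 ≤ 2) (hk2ε : k ^ 2 * |ε| ≤ 4 * n)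
    (hk3 : k ^ 3 ≤ 8 * n ^ 2) :
    -28 ≤ k - 1 - (k ^ 2 / (2 * n) + 2 * k ^ 3 / n ^ 2) +
      ((ε - 2 * ε ^ 2) * (k - 1) - (p + 2 * p ^ 2) * (k * n - k ^ 2 / 2)) := by
  obtain ⟨hε1, hε2⟩ := abs_le.1 hε
  have hexpand : k - 1 - (k ^ 2 / (2 * n) + 2 * k ^ 3 / n ^ 2) +
      ((ε - 2 * ε ^ 2) * (k - 1) - (p + 2 * p ^ 2) * (k * n - k ^ 2 / 2)) =
        -1 - ε - 2 * (k * ε ^ 2) + 2 * ε ^ 2 + ε * (k ^ 2 / n) / 2 - 2 * (k ^ 3 / n ^ 2) -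
          2 * (1 + ε) ^ 2 * (k / n) + (p * k) ^ 2 := by
    obtain rfl : p = (1 + ε) / n := eq_div_of_mul_eq hn.ne' hp
    field_simp
    ring
  have hcubic : k ^ 3 / n ^ 2 ≤ 8 := by rwa [div_le_iff₀ (by positivity)]
  have hlinear : (1 + ε) ^ 2 * (k / n) ≤ 4 * (1 / 2) := by
    have : k / n ≤ 1 / 2 := by rw [div_le_div_iff₀ hn two_pos]; linarith
    gcongr
    nlinarith [hε1]
  have hmixed : -4 ≤ ε * (k ^ 2 / n) := by
    refine (abs_le.1 ?_).1
    rw [abs_mul, abs_of_nonneg (by positivity : 0 ≤ k ^ 2 / n), ← mul_div_assoc, div_le_iff₀ hn]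
    linarith
  rw [hexpand]
  linarith [sq_nonneg ε, sq_nonneg (p * k)]

theorem exp_mul_le_choose_mul_treeComponentProb {n k : ℕ} {p ε : ℝ} (hk : k ≠ 0)
    (h2k : 2 * k ≤ n) (hp : p * n = 1 + ε) (hp2 : p ≤ 1 / 2) (hε : |ε| ≤ 1 / 2)
    (hkε : k * ε ^ 2 ≤ 2) (hk2ε : k ^ 2 * |ε| ≤ 4 * n) (hk3 : (k : ℝ) ^ 3 ≤ 8 * n ^ 2) :
    exp (-28) * n ≤ n.choose k * treeComponentProb p n k * (k ^ 2 * √k) := by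
  have hn : (0 : ℝ) < n := by exact_mod_cast (by lia : 0 < n)
  have hε0 := (abs_le.1 hε).1
  have hp0 : 0 ≤ p := nonneg_of_mul_nonneg_left (hp ▸ by linarith) hn
  have hkpow : (k : ℝ) ^ k = k ^ (k - 2) * k ^ 2 := by
    rcases eq_or_ne k 1 with rfl | hk1
    · simp
    · rw [← pow_add, Nat.sub_add_cancel (by lia)]
  have hnpow : (n : ℝ) ^ k * p ^ (k - 1) = n * (1 + ε) ^ (k - 1) := by
    rw [← hp, mul_pow, ← mul_pow_sub_one hk (n : ℝ)]
    ring
  set a := k - 1 - (k ^ 2 / (2 * n) + 2 * k ^ 3 / n ^ 2 : ℝ)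
  set c := (ε - 2 * ε ^ 2) * (k - 1) - (p + 2 * p ^ 2) * (k * n - k ^ 2 / 2)
  set m := (k - 1).choose 2 + k * (n - k)
  have hac : -28 ≤ a + c := neg_twentyEight_le_exponent hn
    (by exact_mod_cast Nat.one_le_iff_ne_zero.2 hk) (by exact_mod_cast h2k) hp hε hkε hk2ε hk3
  have hq : 0 ≤ 1 - p := by linarith
  calc exp (-28) * n ≤ exp (a + c) * n := by gcongr
    _ = n * exp a * exp c := by rw [exp_add]; ring
    _ ≤ n * exp a * ((1 + ε) ^ (k - 1) * (1 - p) ^ m) := by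
        gcongr
        exact exp_le_pow_mul_one_sub_pow hk (by lia) (by linarith) hp0 hp2
    _ = n ^ k * exp a * (p ^ (k - 1) * (1 - p) ^ m) := by
        linear_combination -(exp a * (1 - p) ^ m) * hnpow
    _ ≤ n.choose k * (k ^ k * √k) * (p ^ (k - 1) * (1 - p) ^ m) := by
        gcongr ?_ * _
        exact pow_mul_exp_le_choose_mul hk h2k
    _ = n.choose k * treeComponentProb p n k * (k ^ 2 * √k) := by
        rw [hkpow, treeComponentProb]
        ring

end Estimates

section Window

open Real

/-- The integers in `[b, 2b]`, the component sizes that are counted. -/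
noncomputable def windowSizes (b : ℝ) : Finset ℕ := Icc ⌈b⌉₊ ⌊2 * b⌋₊

theorem mem_windowSizes {b : ℝ} (hb : 0 ≤ b) {k : ℕ} :
    k ∈ windowSizes b ↔ b ≤ k ∧ (k : ℝ) ≤ 2 * b := by
  rw [windowSizes, mem_Icc, Nat.ceil_le, Nat.le_floor_iff (by positivity)]

theorem half_le_card_windowSizes {b : ℝ} (hb : 2 ≤ b) : b / 2 ≤ #(windowSizes b) := by
  have hceil := Nat.ceil_lt_add_one (show 0 ≤ b by linarith)
  have hfloor := Nat.lt_floor_add_one (2 * b)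
  have hsub : ((⌊2 * b⌋₊ + 1 : ℕ) : ℝ) - ⌈b⌉₊ ≤ (⌊2 * b⌋₊ + 1 - ⌈b⌉₊ : ℕ) := by
    rw [sub_le_iff_le_add]
    exact_mod_cast Nat.sub_le_iff_le_add.1 le_rfl
  rw [windowSizes, Nat.card_Icc]
  push_cast at hsub
  linarith

variable {n : ℕ} {p ε β : ℝ}

theorem abs_le_half_of_abs_mul_le_one (hβ : 2 ≤ β) (hεβ : |ε| * β ≤ 1) : |ε| ≤ 1 / 2 := by
  nlinarith [abs_nonneg ε]

theorem nonneg_of_mul_eq_one_add (hn : (0 : ℝ) < n) (hp : p * n = 1 + ε) (hε : |ε| ≤ 1) : 0 ≤ p :=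
  nonneg_of_mul_nonneg_left (b := (n : ℝ)) (by linarith [(abs_le.1 hε).1]) hn

theorem le_two_div_of_mul_eq_one_add (hn : (0 : ℝ) < n) (hp : p * n = 1 + ε) (hε : |ε| ≤ 1) :
    p ≤ 2 / n := by
  rw [le_div_iff₀ hn]
  linarith [le_of_abs_le hε]

theorem le_half_of_mul_eq_one_add (hn : (4 : ℝ) ≤ n) (hp : p * n = 1 + ε) (hε : |ε| ≤ 1) :
    p ≤ 1 / 2 :=
  (le_two_div_of_mul_eq_one_add (by linarith) hp hε).trans
    ((div_le_div_iff₀ (by linarith) two_pos).2 (by linarith))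

theorem exp_div_le_choose_mul_treeComponentProb (hβ : 2 ≤ β) (hεβ : |ε| * β ≤ 1)
    (hn : 4 * β ^ 3 ≤ n) (hp : p * n = 1 + ε) {k : ℕ} (hk : k ∈ windowSizes (β ^ 2)) :
    exp (-28) * n / (8 * β ^ 5) ≤ n.choose k * treeComponentProb p n k := by
  obtain ⟨hβk, hkβ⟩ := (mem_windowSizes (by positivity)).1 hk
  have hβ0 : 0 < β := by linarith
  have hk0 : k ≠ 0 := by
    rintro rfl
    exact (pow_pos hβ0 2).not_ge (by simpa using hβk)
  have hβ2 : β ^ 2 ≤ β ^ 3 := pow_le_pow_right₀ (by linarith) (by norm_num)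
  have h2k : 2 * k ≤ n := by exact_mod_cast (by linarith : 2 * (k : ℝ) ≤ n)
  have hε := abs_le_half_of_abs_mul_le_one hβ hεβ
  have hn4 : (4 : ℝ) ≤ n := by nlinarith
  have hp0 := nonneg_of_mul_eq_one_add (by linarith) hp (by linarith)
  have hp2 := le_half_of_mul_eq_one_add hn4 hp (by linarith)
  have hkε : k * ε ^ 2 ≤ 2 :=
    calc k * ε ^ 2 ≤ 2 * β ^ 2 * ε ^ 2 := by gcongr
      _ = 2 * (|ε| * β) ^ 2 := by rw [mul_pow, sq_abs]; ring
      _ ≤ 2 * 1 ^ 2 := by gcongr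
      _ = 2 := by norm_num
  have hk2ε : k ^ 2 * |ε| ≤ 4 * n :=
    calc k ^ 2 * |ε| ≤ (2 * β ^ 2) ^ 2 * |ε| := by gcongr
      _ = 4 * β ^ 3 * (|ε| * β) := by ring
      _ ≤ 4 * β ^ 3 * 1 := by gcongr
      _ ≤ 4 * n := by linarith [pow_pos hβ0 3]
  have hk3 : (k : ℝ) ^ 3 ≤ 8 * n ^ 2 :=
    calc (k : ℝ) ^ 3 ≤ (2 * β ^ 2) ^ 3 := by gcongr
      _ = 8 * (β ^ 3) ^ 2 := by ring
      _ ≤ 8 * n ^ 2 := by gcongr; linarith [pow_pos hβ0 3]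
  have hsqrt : √k ≤ 2 * β := sqrt_le_iff.2 ⟨by positivity, by nlinarith⟩
  have ht := treeComponentProb_nonneg hp0 (by linarith) n k
  rw [div_le_iff₀ (by positivity)]
  calc exp (-28) * n ≤ n.choose k * treeComponentProb p n k * (k ^ 2 * √k) :=
        exp_mul_le_choose_mul_treeComponentProb hk0 h2k hp hp2 hε hkε hk2ε hk3
    _ ≤ n.choose k * treeComponentProb p n k * ((2 * β ^ 2) ^ 2 * (2 * β)) := by gcongr
    _ = n.choose k * treeComponentProb p n k * (8 * β ^ 5) := by ring

theorem exp_mul_div_le_sum_choose_mul_treeComponentProb (hβ : 2 ≤ β) (hεβ : |ε| * β ≤ 1)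
    (hn : 4 * β ^ 3 ≤ n) (hp : p * n = 1 + ε) :
    exp (-28) / 16 * (n / β ^ 3) ≤
      ∑ k ∈ windowSizes (β ^ 2), n.choose k * treeComponentProb p n k := by
  have : 0 < β := by linarith
  have hcard : β ^ 2 / 2 ≤ #(windowSizes (β ^ 2)) := half_le_card_windowSizes (by nlinarith)
  calc exp (-28) / 16 * (n / β ^ 3) = β ^ 2 / 2 * (exp (-28) * n / (8 * β ^ 5)) := by
        field_simp
        ring
    _ ≤ #(windowSizes (β ^ 2)) * (exp (-28) * n / (8 * β ^ 5)) := by gcongr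
    _ ≤ _ := by
        rw [← nsmul_eq_mul]
        exact card_nsmul_le_sum _ _ _ fun k hk =>
          exp_div_le_choose_mul_treeComponentProb hβ hεβ hn hp hk

theorem mul_mul_exponent_le (hβ : 2 ≤ β) (hεβ : |ε| * β ≤ 1) (hn : 72 * β ^ 3 ≤ n)
    (hp : p * n = 1 + ε) {j k : ℕ} (hj : j ≤ 2 * β ^ 2) (hk : k ≤ 2 * β ^ 2) :
    j * k * (p + 2 * p ^ 2 - 1 / n) ≤ 36 * (β ^ 3 / n) := by
  have hβ0 : 0 < β := by linarith
  have hn0 : (0 : ℝ) < n := lt_of_lt_of_le (by positivity) hn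
  have hβn : β / n ≤ 1 := by
    rw [div_le_one hn0]
    nlinarith [pow_pos hβ0 2]
  have hε : |ε| ≤ 1 := (abs_le_half_of_abs_mul_le_one hβ hεβ).trans (by norm_num)
  have hp0 := nonneg_of_mul_eq_one_add hn0 hp hε
  have hpn := le_two_div_of_mul_eq_one_add hn0 hp hε
  have hbracket : p + 2 * p ^ 2 - 1 / n ≤ |ε| / n + 8 / n ^ 2 :=
    calc p + 2 * p ^ 2 - 1 / n = ε / n + 2 * p ^ 2 := by
          rw [eq_div_of_mul_eq hn0.ne' hp]
          ring
      _ ≤ |ε| / n + 2 * (2 / n) ^ 2 := by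
          gcongr
          exact le_abs_self ε
      _ = |ε| / n + 8 / n ^ 2 := by ring
  calc j * k * (p + 2 * p ^ 2 - 1 / n) ≤ j * k * (|ε| / n + 8 / n ^ 2) := by gcongr
    _ ≤ 2 * β ^ 2 * (2 * β ^ 2) * (|ε| / n + 8 / n ^ 2) := by gcongr
    _ = 4 * (β ^ 3 / n) * (|ε| * β) + 32 * (β ^ 3 / n) * (β / n) := by field_simp; ring
    _ ≤ 4 * (β ^ 3 / n) * 1 + 32 * (β ^ 3 / n) * 1 := by gcongr
    _ = 36 * (β ^ 3 / n) := by ring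

theorem choose_sub_le_one_add_mul (hβ : 2 ≤ β) (hεβ : |ε| * β ≤ 1) (hn : 72 * β ^ 3 ≤ n)
    (hp : p * n = 1 + ε) {j k : ℕ} (hj : j ≤ 2 * β ^ 2) (hk : k ≤ 2 * β ^ 2) :
    ((n - j).choose k : ℝ) ≤ (1 + 72 * (β ^ 3 / n)) * (1 - p) ^ (j * k) * n.choose k := by
  have hn0 : (0 : ℝ) < n := lt_of_lt_of_le (by positivity) hn
  have hx : 36 * (β ^ 3 / n) ≤ 1 / 2 := by
    rw [← mul_div_assoc, div_le_iff₀ hn0]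
    linarith
  have hn4 : (4 : ℝ) ≤ n := by nlinarith [pow_le_pow_left₀ zero_le_two hβ 3]
  have hp2 := le_half_of_mul_eq_one_add hn4 hp
    ((abs_le_half_of_abs_mul_le_one hβ hεβ).trans (by norm_num))
  have hexponent := mul_mul_exponent_le hβ hεβ hn hp hj hk
  calc ((n - j).choose k : ℝ) ≤ n.choose k * exp (-(j * k / n)) := choose_sub_le n j k
    _ = n.choose k * (exp (j * k * (p + 2 * p ^ 2 - 1 / n)) *
          exp (-((p + 2 * p ^ 2) * (j * k : ℕ)))) := by
        rw [← exp_add]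
        push_cast
        ring_nf
    _ ≤ n.choose k * ((1 + 2 * (36 * (β ^ 3 / n))) * (1 - p) ^ (j * k)) := by
        gcongr
        · exact (exp_le_exp.2 hexponent).trans (exp_le_one_add_two_mul (by positivity) hx)
        · exact exp_neg_mul_le_one_sub_pow hp2 _
    _ = (1 + 72 * (β ^ 3 / n)) * (1 - p) ^ (j * k) * n.choose k := by ring

theorem binomialRandom_real_ncard_componentsInWindow_sq_le {V : Type*} [Fintype V]
    {p : unitInterval} (hβ : 2 ≤ β) (hεβ : |ε| * β ≤ 1) (hn : 72 * β ^ 3 ≤ Fintype.card V)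
    (hp : (p : ℝ) * Fintype.card V = 1 + ε) :
    (SimpleGraph.binomialRandom V p).real {G | ((componentsInWindow G (β ^ 2)).ncard : ℝ) ≤
        exp (-28) / 32 * (Fintype.card V / β ^ 3)} ≤
      (64 * exp 28 + 288) * (β ^ 3 / Fintype.card V) := by
  set n := Fintype.card V
  have hβ0 : 0 < β := by linarith
  have hn0 : (0 : ℝ) < n := lt_of_lt_of_le (by positivity) hn
  set M := ∑ k ∈ windowSizes (β ^ 2), n.choose k * treeComponentProb p n k with hM
  have hMge : exp (-28) / 16 * (n / β ^ 3) ≤ M :=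
    exp_mul_div_le_sum_choose_mul_treeComponentProb hβ hεβ (by linarith [pow_pos hβ0 3]) hp
  have hM0 : 0 < M := lt_of_lt_of_le (by positivity) hMge
  have hMinv : 1 / M ≤ 16 * exp 28 * (β ^ 3 / n) :=
    calc 1 / M ≤ 1 / (exp (-28) / 16 * (n / β ^ 3)) := by gcongr
      _ = 16 * exp 28 * (β ^ 3 / n) := by rw [exp_neg]; field_simp
  have hn4 : (4 : ℝ) ≤ n := by nlinarith [pow_le_pow_left₀ zero_le_two hβ 3]
  have hp2 := le_half_of_mul_eq_one_add hn4 hp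
    ((abs_le_half_of_abs_mul_le_one hβ hεβ).trans (by norm_num))
  have hW : ∀ k ∈ windowSizes (β ^ 2), β ^ 2 ≤ k ∧ (k : ℝ) ≤ 2 * β ^ 2 :=
    fun k => (mem_windowSizes (by positivity)).1
  have htail := binomialRandom_real_ncard_componentsInWindow_le_half (V := V) (p := p)
    (by positivity) hW (by linarith) hM0 hM.symm
    fun j hj k hk => choose_sub_le_one_add_mul hβ hεβ hn hp (hW j hj).2 (hW k hk).2
  calc (SimpleGraph.binomialRandom V p).real {G | ((componentsInWindow G (β ^ 2)).ncard : ℝ) ≤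
          exp (-28) / 32 * (n / β ^ 3)}
      ≤ (SimpleGraph.binomialRandom V p).real
          {G | ((componentsInWindow G (β ^ 2)).ncard : ℝ) ≤ M / 2} :=
        measureReal_mono (Set.ofPred_subset_ofPred.2 fun _ hG => hG.trans (by linarith))
    _ ≤ 4 * (1 / M + 72 * (β ^ 3 / n)) := htail
    _ ≤ (64 * exp 28 + 288) * (β ^ 3 / n) := by linarith

theorem binomialRandom_real_ncard_componentsInWindow_le {V : Type*} [Fintype V]
    {p : unitInterval} {b : ℝ} (hb : 4 ≤ b) (hεb : ε ^ 2 * b ≤ 1)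
    (hp : (p : ℝ) * Fintype.card V = 1 + ε) :
    (SimpleGraph.binomialRandom V p).real {G | ((componentsInWindow G b).ncard : ℝ) ≤
        exp (-28) / 32 * (Fintype.card V / b ^ (3 / 2 : ℝ))} ≤
      (64 * exp 28 + 288) * (b ^ (3 / 2 : ℝ) / Fintype.card V) := by
  have hb0 : 0 ≤ b := by linarith
  have hβ : 2 ≤ √b := (le_sqrt' two_pos).2 (by linarith)
  have hβ3 : b ^ (3 / 2 : ℝ) = √b ^ 3 := by
    rw [sqrt_eq_rpow, ← rpow_natCast, ← rpow_mul hb0]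
    norm_num
  have hεβ : |ε| * √b ≤ 1 := by
    rw [← abs_one, ← abs_of_nonneg (sqrt_nonneg b), ← abs_mul, ← sq_le_sq, mul_pow, sq_sqrt hb0]
    linarith
  rw [hβ3]
  rcases le_or_gt (72 * √b ^ 3) (Fintype.card V : ℝ) with hn | hn
  · have h := binomialRandom_real_ncard_componentsInWindow_sq_le hβ hεβ hn hp
    rwa [sq_sqrt hb0] at h
  · have hε := (abs_le.1 (abs_le_half_of_abs_mul_le_one hβ hεβ)).1
    have hn0 : (0 : ℝ) < Fintype.card V := pos_of_mul_pos_right (hp ▸ by linarith) p.2.1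
    refine measureReal_le_one.trans ?_
    rw [← mul_div_assoc, le_div_iff₀ hn0]
    nlinarith [exp_pos 28, pow_nonneg (sqrt_nonneg b) 3]

theorem binomialRandom_criticalEdgeProb_real_ncard_componentsInWindow_le {n : ℕ} {l b : ℝ}
    (hn : n ≠ 0) (hb : 4 ≤ b) (hlb : l ^ 2 * b ≤ (n : ℝ) ^ (2 / 3 : ℝ))
    (hp : criticalEdgeProb n l ∈ unitInterval) :
    (SimpleGraph.binomialRandom (Fin n) ⟨criticalEdgeProb n l, hp⟩).real
        {G | ((componentsInWindow G b).ncard : ℝ) ≤ exp (-28) / 32 * (n / b ^ (3 / 2 : ℝ))} ≤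
      (64 * exp 28 + 288) * (b ^ (3 / 2 : ℝ) / n) := by
  have hn0 : (0 : ℝ) < n := by positivity
  have hεb : (l * (n : ℝ) ^ (-(1 / 3) : ℝ)) ^ 2 * b ≤ 1 :=
    calc (l * (n : ℝ) ^ (-(1 / 3) : ℝ)) ^ 2 * b = l ^ 2 * b * (n : ℝ) ^ (-(2 / 3) : ℝ) := by
          rw [mul_pow, ← rpow_mul_natCast hn0.le]
          norm_num
          ring
      _ ≤ (n : ℝ) ^ (2 / 3 : ℝ) * (n : ℝ) ^ (-(2 / 3) : ℝ) := by gcongr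
      _ = 1 := by rw [← rpow_add hn0, add_neg_cancel, rpow_zero]
  have h := binomialRandom_real_ncard_componentsInWindow_le (V := Fin n)
    (p := ⟨criticalEdgeProb n l, hp⟩) hb hεb
    (by simp only [Fintype.card_fin, criticalEdgeProb, div_mul_cancel₀ _ hn0.ne'])
  rwa [Fintype.card_fin] at h

end Window

theorem mainTheorem8_general (lam B : ℕ → ℝ)
    (hlam : ∀ᶠ n : ℕ in atTop, lam n ^ 2 * B n ≤ (n : ℝ) ^ (2 / 3 : ℝ))
    (hB : ∀ᶠ n in atTop, 4 ≤ B n) :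
    ∃ δ₁ δ₂ : ℝ, 0 < δ₁ ∧ 0 < δ₂ ∧
      ∀ n : ℕ, 1 ≤ n → 0 < B n →
        ∀ hp : criticalEdgeProb n (lam n) ∈ unitInterval,
          (SimpleGraph.binomialRandom (Fin n) ⟨criticalEdgeProb n (lam n), hp⟩).real
              {G : SimpleGraph (Fin n) |
                ((componentsInWindow G (B n)).ncard : ℝ) ≤ δ₁ * n / B n ^ (3 / 2 : ℝ)}
            ≤ δ₂ * B n ^ (3 / 2 : ℝ) / n := by
  obtain ⟨N, hN⟩ := eventually_atTop.1 (hlam.and hB)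
  set S : ℝ := ∑ m ∈ range N, |m / B m ^ (3 / 2 : ℝ)|
  have hS : 0 ≤ S := sum_nonneg fun _ _ => abs_nonneg _
  refine ⟨Real.exp (-28) / 32, 64 * Real.exp 28 + 288 + S, by positivity, by positivity, ?_⟩
  intro n hn hBn hp
  have : (0 : ℝ) < n := by exact_mod_cast hn
  simp only [mul_div_assoc]
  rcases lt_or_ge n N with hnN | hnN
  · have hterm : (n : ℝ) / B n ^ (3 / 2 : ℝ) ≤ S := (le_abs_self _).trans
      (single_le_sum (f := fun m : ℕ => |(m : ℝ) / B m ^ (3 / 2 : ℝ)|)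
        (fun _ _ => abs_nonneg _) (mem_range.2 hnN))
    calc _ ≤ (1 : ℝ) := measureReal_le_one
      _ = n / B n ^ (3 / 2 : ℝ) * (B n ^ (3 / 2 : ℝ) / n) := by field_simp
      _ ≤ _ := by
          gcongr
          linarith [Real.exp_pos 28]
  · obtain ⟨hlamn, hBn4⟩ := hN n hnN
    refine (binomialRandom_criticalEdgeProb_real_ncard_componentsInWindow_le
      (by lia) hBn4 hlamn hp).trans ?_
    exact mul_le_mul_of_nonneg_right (le_add_of_nonneg_right hS) (by positivity)

theorem sq_mul_le_of_le_div_sq {l γ b c : ℝ} (hl : |l| ≤ γ) (hγ : 0 < γ) (hc : 0 ≤ c)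
    (hb : b ≤ c / γ ^ 2) : l ^ 2 * b ≤ c :=
  calc l ^ 2 * b ≤ l ^ 2 * (c / γ ^ 2) := by gcongr
    _ ≤ γ ^ 2 * (c / γ ^ 2) := by
        gcongr ?_ * _
        exact sq_le_sq' (abs_le.1 hl).1 (abs_le.1 hl).2
    _ = c := mul_div_cancel₀ c (by positivity)

theorem mainTheorem8
    (g lam B : ℕ → ℝ)
    (hg_pos : ∀ n, 0 < g n)
    (hg_mono : Monotone g)
    (hg_tendsto : Tendsto g atTop atTop)
    (hg_small : g =o[atTop] fun n : ℕ => (n : ℝ) ^ (1 / 3 : ℝ))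
    (hlam : ∀ n, 1 ≤ n → |lam n| ≤ g n)
    (hB : ∀ n, 1 ≤ n → B n ≤ (n : ℝ) ^ (2 / 3 : ℝ) / g n ^ 2)
    (hB_tendsto : Tendsto B atTop atTop) :
    ∃ δ₁ δ₂ : ℝ, 0 < δ₁ ∧ 0 < δ₂ ∧
      ∀ n : ℕ, 1 ≤ n → 0 < B n →
        ∀ hp : criticalEdgeProb n (lam n) ∈ unitInterval,
          (SimpleGraph.binomialRandom (Fin n) ⟨criticalEdgeProb n (lam n), hp⟩).real
              {G : SimpleGraph (Fin n) |
                ((componentsInWindow G (B n)).ncard : ℝ) ≤ δ₁ * n / B n ^ (3 / 2 : ℝ)}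
            ≤ δ₂ * B n ^ (3 / 2 : ℝ) / n :=
  mainTheorem8_general lam B
    ((eventually_ge_atTop 1).mono fun n hn =>
      sq_mul_le_of_le_div_sq (hlam n hn) (hg_pos n) (by positivity) (hB n hn))
    (hB_tendsto.eventually_ge_atTop 4)
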